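/- **Definitions.** A *memoryful neural multi-agent system* (MN-MAS) $S$ with $s$ agents consists of a state space $\mathcal X\subseteq\mathbb R^m$ with a set of initial states $\mathcal X^{(0)}\subseteq\mathcal X$; for each agent $i$ an observation space $\mathcal O_i\subseteq\mathbb R^{\ell_i}$, an action space $\mathcal A_i\subseteq\mathbb R^{k_i}$, and a set of hidden states $\mathcal H_i\subseteq\mathbb R^{n_i}$ with a subset $\mathcal H_i^{(0)}$ of initial hidden states; a transition relation $\tau:\mathcal X\times\prod_i\mathcal A_i\to 2^{\mathcal X}$; observation functions $o_i:\mathcal X\to\mathcal O_i$; and policies given by recurrent functions $r_i:\mathcal O_i\times\mathcal H_i\to\mathcal A_i\times\mathcal H_i$. A *path* of $S$ is an infinite sequence $(x^{(t)},h^{(t)})_{t\ge0}$ in $\mathcal X\times\prod_i\mathcal H_i$ with $(a_i^{(t)},h_i^{(t+1)})=r_i(o_i(x^{(t)}),h_i^{(t)})$ for all $i$ and $x^{(t+1)}\in\tau(x^{(t)},a_1^{(t)},\dots,a_s^{(t)})$ for all $t\ge 0$. The formulas of $\mathrm{LTL}_{\mathbb R}$ are $$\varphi::=c\cdot x\le d\mid\neg\varphi\mid\varphi\wedge\varphi\mid\varphi\vee\varphi\mid\bigcirc\varphi\mid\varphi\,\mathcal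 U\varphi\mid\varphi\,\mathcal R\varphi\mid\square\varphi\mid\lozenge\varphi,$$ with $c\in\mathbb R^m$, $d\in\mathbb R$, where $x$ is the environment state, with the usual semantics of linear temporal logic along a path ($\psi\,\mathcal R\varphi$ holds if $\varphi$ holds forever, or up to and including a time at which $\psi$ holds). A formula is *unbounded* if it contains $\mathcal U$, $\mathcal R$, $\square$ or $\lozenge$. We write $S\models\varphi$ if every path that starts in $\mathcal X^{(0)}\times\prod_i\mathcal H_i^{(0)}$ satisfies $\varphi$ at time $0$. For the decision problems, a system is given by its dimensions and by finite conjunctions of finite disjunctions of non-strict linear inequalities with rational coefficients that define $\mathcal X,\mathcal X^{(0)},\mathcal O_i,\mathcal A_i,\mathcal H_i,\mathcal H_i^{(0)}$ and the graphs of $\tau$, $o_i$, $r_i$; a formula is given as a word, with rational constants. An algorithm is only required to be correct on inputs that do describe a system and a formula over its states. A *(single-layer ReLU) RNN* with rational weights is given by rational matrices $W,U,V$, rational vectors $b,d$ and a rational initial hidden state $h^{(0)}$; it realises the policy $r(o,h)=(Vh'+d,\,h')$ with $h'=\mathrm{ReLU}(Wh+Uo+b)$. **Theorem.** 1. $\mathrm{LTL}_{\mathbb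 R}$ verification of MN-MAS is undecidable: there is no algorithm that, given an MN-MAS $S$ and an $\mathrm{LTL}_{\mathbb R}$ formula $\varphi$, decides whether $S\models\varphi$. 2. This remains so if the algorithm is only required to be correct for unbounded formulas $\varphi$. 3. For every fixed real number $c$ with $0<c<1$, the following problem is undecidable. Given $n\ge1$, an RNN with rational weights and with $n$ inputs and $n$ outputs, and $x^{(0)}\in\mathbb Q^n$, decide whether $S\models\lozenge(a_1>c)$, where $S$ is the fully observable MN-MAS with this RNN as its only agent, $\mathcal X=\mathcal O=\mathcal A=\mathbb R^n$, the given initial state and initial hidden state, identity observation function and transition function $\tau(x,a)=a$, and $a_1$ is the first coordinate of the agent's action. (As $x^{(t+1)}=a^{(t)}$, the condition $\lozenge(a_1>c)$ is the $\mathrm{LTL}_{\mathbb R}$ formula $\lozenge\bigcirc\neg(x_1\le c)$.) -/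

import Mathlib

noncomputable section

namespace MNMASVerification

/-! Memoryful neural multi-agent systems -/

/-- A memoryful neural multi-agent system. The joint action space, joint observation space and
joint set of hidden states are the products of the spaces of the agents. A memoryless agent has
`hidDim i = 0`, i.e. a trivial memory. -/
structure MNMAS where
  numAgents : ℕ
  stateDim : ℕ
  obsDim : Fin numAgents → ℕ
  actDim : Fin numAgents → ℕ
  hidDim : Fin numAgents → ℕ
  /-- the state space of the environment -/
  X : Set (Fin stateDim → ℝ)
  /-- the observation spaces -/
  O : ∀ i, Set (Fin (obsDim i) → ℝ)
  /-- the action spaces -/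
  A : ∀ i, Set (Fin (actDim i) → ℝ)
  /-- the sets of hidden states -/
  H : ∀ i, Set (Fin (hidDim i) → ℝ)
  /-- the initial states of the environment -/
  X₀ : Set X
  /-- the initial hidden states -/
  H₀ : ∀ i, Set (H i)
  /-- the transition relation of the environment -/
  τ : X → (∀ i, A i) → Set X
  /-- the observation functions -/
  obs : ∀ i, X → O i
  /-- the recurrent functions of the policies, `r i o h = (action, new hidden state)` -/
  r : ∀ i, O i → H i → A i × H i

namespace MNMAS

variable (S : MNMAS)

/-- The joint action performed at time `t` along a sequence of joint system states. -/
def action (π : ℕ → S.X × (∀ i, S.H i)) (t : ℕ) (i : Fin S.numAgents) : S.A i :=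
  (S.r i (S.obs i (π t).1) ((π t).2 i)).1

/-- The infinite paths of `S` (starting anywhere). -/
def IsPath (π : ℕ → S.X × (∀ i, S.H i)) : Prop :=
  ∀ t, (π (t + 1)).1 ∈ S.τ (π t).1 (S.action π t) ∧
    ∀ i, (π (t + 1)).2 i = (S.r i (S.obs i (π t).1) ((π t).2 i)).2

end MNMAS

/-! Linear temporal logic over the reals -/

/-- Formulas of linear temporal logic whose atoms are linear inequalities `c · x ≤ d` in `m`
variables, with constants from `K`. -/
inductive LTL (K : Type) (m : ℕ) : Type
  | atom (c : Fin m → K) (d : K) : LTL K m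
  | neg (φ : LTL K m) : LTL K m
  | conj (φ ψ : LTL K m) : LTL K m
  | disj (φ ψ : LTL K m) : LTL K m
  | next (φ : LTL K m) : LTL K m
  | untl (φ ψ : LTL K m) : LTL K m
  | release (φ ψ : LTL K m) : LTL K m
  | always (φ : LTL K m) : LTL K m
  | eventually (φ : LTL K m) : LTL K m

namespace LTL

/-- A formula is unbounded if it contains one of the operators until, release, always,
eventually. -/
def IsUnbounded {K : Type} {m : ℕ} : LTL K m → Prop
  | atom _ _ => False
  | neg φ => φ.IsUnbounded
  | conj φ ψ => φ.IsUnbounded ∨ ψ.IsUnbounded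
  | disj φ ψ => φ.IsUnbounded ∨ ψ.IsUnbounded
  | next φ => φ.IsUnbounded
  | untl _ _ => True
  | release _ _ => True
  | always _ => True
  | eventually _ => True

/-- Apply a map to all constants of a formula. -/
def map {K L : Type} {m : ℕ} (f : K → L) : LTL K m → LTL L m
  | atom c d => atom (fun j => f (c j)) (f d)
  | neg φ => neg (φ.map f)
  | conj φ ψ => conj (φ.map f) (ψ.map f)
  | disj φ ψ => disj (φ.map f) (ψ.map f)
  | next φ => next (φ.map f)
  | untl φ ψ => untl (φ.map f) (ψ.map f)
  | release φ ψ => release (φ.map f) (ψ.map f)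
  | always φ => always (φ.map f)
  | eventually φ => eventually (φ.map f)

/-- Satisfaction of a formula at time `t` along a sequence of environment states. -/
def SatAt {m : ℕ} (x : ℕ → Fin m → ℝ) : ℕ → LTL ℝ m → Prop
  | t, atom c d => ∑ j, c j * x t j ≤ d
  | t, neg φ => ¬ SatAt x t φ
  | t, conj φ ψ => SatAt x t φ ∧ SatAt x t ψ
  | t, disj φ ψ => SatAt x t φ ∨ SatAt x t ψ
  | t, next φ => SatAt x (t + 1) φ
  | t, untl ψ φ => ∃ i, SatAt x (t + i) φ ∧ ∀ j < i, SatAt x (t + j) ψ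
  | t, release ψ φ => (∀ i, SatAt x (t + i) φ) ∨
      ∃ i, SatAt x (t + i) ψ ∧ ∀ j ≤ i, SatAt x (t + j) φ
  | t, always φ => ∀ i, SatAt x (t + i) φ
  | t, eventually φ => ∃ i, SatAt x (t + i) φ

end LTL

/-- `S ⊨ φ`: every path that starts in an initial state satisfies `φ` at time `0`. -/
def MNMAS.Satisfies (S : MNMAS) (φ : LTL ℝ S.stateDim) : Prop :=
  ∀ π : ℕ → S.X × (∀ i, S.H i), S.IsPath π →
    (π 0).1 ∈ S.X₀ → (∀ i, (π 0).2 i ∈ S.H₀ i) →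
    LTL.SatAt (fun t => ((π t).1 : Fin S.stateDim → ℝ)) 0 φ

/-! Finite descriptions of linearly definable systems and of formulas -/

/-- `(p, q)` stands for the rational number `p / (q + 1)`. -/
abbrev RatCode := ℤ × ℕ

/-- The rational number that a code stands for, as a real number. -/
def RatCode.val (q : RatCode) : ℝ := (q.1 : ℝ) / ((q.2 : ℝ) + 1)

/-- A linear inequality `c · v ≤ d` with rational constants; missing coefficients are `0`. -/
abbrev IneqCode := List RatCode × RatCode

/-- Whether `v` satisfies the inequality. -/
def IneqCode.Holds (e : IneqCode) (v : List ℝ) : Prop :=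
  (List.zipWith (fun q y => RatCode.val q * y) e.1 v).sum ≤ RatCode.val e.2

/-- A finite conjunction of finite disjunctions of linear inequalities. -/
abbrev ConstraintCode := List (List IneqCode)

/-- Whether `v` satisfies the conjunction of disjunctions. -/
def ConstraintCode.Holds (C : ConstraintCode) (v : List ℝ) : Prop :=
  ∀ D ∈ C, ∃ e ∈ D, IneqCode.Holds e v

/-- Description of an agent. The constraint `obs` is over the variables `(x, o)`, and `r` is
over `(o, h, a, h')`. -/
structure AgentCode where
  obsDim : ℕ
  actDim : ℕ
  hidDim : ℕ
  O : ConstraintCode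
  A : ConstraintCode
  H : ConstraintCode
  H₀ : ConstraintCode
  obs : ConstraintCode
  r : ConstraintCode

/-- An agent description as a tuple. -/
def AgentCode.equiv : AgentCode ≃ ℕ × ℕ × ℕ × ConstraintCode × ConstraintCode ×
    ConstraintCode × ConstraintCode × ConstraintCode × ConstraintCode where
  toFun a := (a.obsDim, a.actDim, a.hidDim, a.O, a.A, a.H, a.H₀, a.obs, a.r)
  invFun p := ⟨p.1, p.2.1, p.2.2.1, p.2.2.2.1, p.2.2.2.2.1, p.2.2.2.2.2.1, p.2.2.2.2.2.2.1,
    p.2.2.2.2.2.2.2.1, p.2.2.2.2.2.2.2.2⟩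
  left_inv _ := rfl
  right_inv _ := rfl

instance : Primcodable AgentCode := Primcodable.ofEquiv _ AgentCode.equiv

/-- Description of a linearly definable system. The constraint `τ` is over the variables
`(x, a₁, …, aₛ, x')`. -/
structure SystemCode where
  stateDim : ℕ
  X : ConstraintCode
  X₀ : ConstraintCode
  τ : ConstraintCode
  agents : List AgentCode

/-- A system description as a tuple. -/
def SystemCode.equiv : SystemCode ≃ ℕ × ConstraintCode × ConstraintCode × ConstraintCode ×
    List AgentCode where
  toFun a := (a.stateDim, a.X, a.X₀, a.τ, a.agents)
  invFun p := ⟨p.1, p.2.1, p.2.2.1, p.2.2.2.1, p.2.2.2.2⟩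
  left_inv _ := rfl
  right_inv _ := rfl

instance : Primcodable SystemCode := Primcodable.ofEquiv _ SystemCode.equiv

/-- The subset of `ℝ^k` that a constraint describes. -/
def ConstraintCode.set (C : ConstraintCode) (k : ℕ) : Set (Fin k → ℝ) :=
  {v | ConstraintCode.Holds C (List.ofFn v)}

/-- The observation constraint of the agent, as a relation between states and observations. -/
def AgentCode.ObsRel {m : ℕ} (a : AgentCode) (x : Fin m → ℝ) (o : Fin a.obsDim → ℝ) : Prop :=
  ConstraintCode.Holds a.obs (List.ofFn x ++ List.ofFn o)

/-- The policy constraint of the agent, as a relation between inputs and outputs. -/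
def AgentCode.PolicyRel (a : AgentCode) (o : Fin a.obsDim → ℝ) (h : Fin a.hidDim → ℝ)
    (u : Fin a.actDim → ℝ) (h' : Fin a.hidDim → ℝ) : Prop :=
  ConstraintCode.Holds a.r (List.ofFn o ++ List.ofFn h ++ List.ofFn u ++ List.ofFn h')

/-- The description is well formed: the constraints for the observations and for the recurrent
policies define functions between the respective spaces. -/
structure SystemCode.Valid (c : SystemCode) : Prop where
  obs : ∀ i : Fin c.agents.length, ∀ x : ConstraintCode.set c.X c.stateDim,
    ∃! o : ConstraintCode.set (c.agents.get i).O (c.agents.get i).obsDim,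
      (c.agents.get i).ObsRel x.1 o.1
  r : ∀ i : Fin c.agents.length,
    ∀ o : ConstraintCode.set (c.agents.get i).O (c.agents.get i).obsDim,
    ∀ h : ConstraintCode.set (c.agents.get i).H (c.agents.get i).hidDim,
    ∃! p : ConstraintCode.set (c.agents.get i).A (c.agents.get i).actDim ×
        ConstraintCode.set (c.agents.get i).H (c.agents.get i).hidDim,
      (c.agents.get i).PolicyRel o.1 h.1 p.1.1 p.2.1

/-- The system that a well-formed description describes. -/
def SystemCode.system (c : SystemCode) (hc : c.Valid) : MNMAS where
  numAgents := c.agents.length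
  stateDim := c.stateDim
  obsDim i := (c.agents.get i).obsDim
  actDim i := (c.agents.get i).actDim
  hidDim i := (c.agents.get i).hidDim
  X := ConstraintCode.set c.X c.stateDim
  O i := ConstraintCode.set (c.agents.get i).O (c.agents.get i).obsDim
  A i := ConstraintCode.set (c.agents.get i).A (c.agents.get i).actDim
  H i := ConstraintCode.set (c.agents.get i).H (c.agents.get i).hidDim
  X₀ := {x | ConstraintCode.Holds c.X₀ (List.ofFn x.1)}
  H₀ i := {h | ConstraintCode.Holds (c.agents.get i).H₀ (List.ofFn h.1)}
  τ x a := {x' | ConstraintCode.Holds c.τ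
    (List.ofFn x.1 ++ (List.ofFn fun i => List.ofFn (a i).1).flatten ++ List.ofFn x'.1)}
  obs i x := (hc.obs i x).choose
  r i o h := (hc.r i o h).choose

/-- Letters of the words that describe formulas: an atom, or one of eight operators. -/
abbrev Token := IneqCode ⊕ Fin 8

/-- A formula with rational constants, written in prefix notation. -/
def LTL.word {m : ℕ} : LTL RatCode m → List Token
  | atom c d => [Sum.inl (List.ofFn c, d)]
  | neg φ => Sum.inr 0 :: φ.word
  | conj φ ψ => Sum.inr 1 :: (φ.word ++ ψ.word)
  | disj φ ψ => Sum.inr 2 :: (φ.word ++ ψ.word)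
  | next φ => Sum.inr 3 :: φ.word
  | untl φ ψ => Sum.inr 4 :: (φ.word ++ ψ.word)
  | release φ ψ => Sum.inr 5 :: (φ.word ++ ψ.word)
  | always φ => Sum.inr 6 :: φ.word
  | eventually φ => Sum.inr 7 :: φ.word

/-- An algorithm `f` decides, given a description of a system `S` and a formula `φ` that
satisfies `P`, whether `S ⊨ φ`. Nothing is required of `f` on ill-formed inputs. -/
def DecidesVerification (P : ∀ m : ℕ, LTL RatCode m → Prop)
    (f : SystemCode × List Token → Bool) : Prop :=
  ∀ (c : SystemCode) (hc : c.Valid) (φ : LTL RatCode c.stateDim), P c.stateDim φ →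
    (f (c, φ.word) = true ↔ (c.system hc).Satisfies (φ.map RatCode.val))

/-! Fully observable systems with one recurrent neural network agent -/

/-- A recurrent neural network with `n` inputs, `n` outputs, and one recurrent ReLU layer of
`p` units. -/
structure RNN (n p : ℕ) where
  /-- recurrent weights -/
  W : Matrix (Fin p) (Fin p) ℝ
  /-- input weights -/
  U : Matrix (Fin p) (Fin n) ℝ
  /-- bias of the recurrent layer -/
  b : Fin p → ℝ
  /-- output weights -/
  V : Matrix (Fin n) (Fin p) ℝ
  /-- output bias -/
  d : Fin n → ℝ
  /-- initial hidden state -/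
  h₀ : Fin p → ℝ

/-- The next hidden state, `ReLU (W h + U o + b)`. -/
def RNN.hidden {n p : ℕ} (R : RNN n p) (o : Fin n → ℝ) (h : Fin p → ℝ) : Fin p → ℝ :=
  fun k => max 0 ((R.W.mulVec h + R.U.mulVec o + R.b) k)

/-- The output, an affine function of the new hidden state. -/
def RNN.output {n p : ℕ} (R : RNN n p) (o : Fin n → ℝ) (h : Fin p → ℝ) : Fin n → ℝ :=
  R.V.mulVec (R.hidden o h) + R.d

/-- The system with the single agent `R`, state, observation and action space `ℝ^n`, identity
observation function, transition function `τ (x, a) = a`, and initial state `x₀`. -/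
def RNN.system {n p : ℕ} (R : RNN n p) (x₀ : Fin n → ℝ) : MNMAS where
  numAgents := 1
  stateDim := n
  obsDim _ := n
  actDim _ := n
  hidDim _ := p
  X := Set.univ
  O _ := Set.univ
  A _ := Set.univ
  H _ := Set.univ
  X₀ := {x | x.1 = x₀}
  H₀ _ := {h | h.1 = R.h₀}
  τ _ a := {x' | x'.1 = (a 0).1}
  obs _ x := ⟨x.1, trivial⟩
  r _ o h := (⟨R.output o.1 h.1, trivial⟩, ⟨R.hidden o.1 h.1, trivial⟩)

/-- Description of a network with rational weights, together with an initial state of the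
environment. The input and output dimension is `dim + 1`, so that there is a first coordinate.
Matrices are lists of rows; missing entries are `0`. -/
structure RNNCode where
  dim : ℕ
  units : ℕ
  W : List (List RatCode)
  U : List (List RatCode)
  b : List RatCode
  V : List (List RatCode)
  d : List RatCode
  h₀ : List RatCode
  x₀ : List RatCode

/-- A network description as a tuple. -/
def RNNCode.equiv : RNNCode ≃ ℕ × ℕ × List (List RatCode) × List (List RatCode) ×
    List RatCode × List (List RatCode) × List RatCode × List RatCode × List RatCode where
  toFun a := (a.dim, a.units, a.W, a.U, a.b, a.V, a.d, a.h₀, a.x₀)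
  invFun p := ⟨p.1, p.2.1, p.2.2.1, p.2.2.2.1, p.2.2.2.2.1, p.2.2.2.2.2.1, p.2.2.2.2.2.2.1,
    p.2.2.2.2.2.2.2.1, p.2.2.2.2.2.2.2.2⟩
  left_inv _ := rfl
  right_inv _ := rfl

instance : Primcodable RNNCode := Primcodable.ofEquiv _ RNNCode.equiv

/-- The vector in `ℝ^k` described by a list. -/
def vecOf (k : ℕ) (l : List RatCode) : Fin k → ℝ :=
  fun i => RatCode.val (l.getD i (0, 0))

/-- The matrix described by a list of rows. -/
def matOf (k l : ℕ) (M : List (List RatCode)) : Matrix (Fin k) (Fin l) ℝ :=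
  fun i => vecOf l (M.getD i [])

/-- The network that a description describes. -/
def RNNCode.rnn (c : RNNCode) : RNN (c.dim + 1) c.units where
  W := matOf _ _ c.W
  U := matOf _ _ c.U
  b := vecOf _ c.b
  V := matOf _ _ c.V
  d := vecOf _ c.d
  h₀ := vecOf _ c.h₀

/-- The single-agent system that a description describes. -/
def RNNCode.system (c : RNNCode) : MNMAS := c.rnn.system (vecOf _ c.x₀)

/-- The formula `◇ (a₁ > c)` for systems with `τ (x, a) = a`. There the action at time `t` is
the environment state at time `t + 1`, so that `a₁ > c` is the formula `○ ¬ (x₁ ≤ c)`. -/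
def eventuallyActionGt (n : ℕ) (c : ℝ) : LTL ℝ (n + 1) :=
  LTL.eventually (LTL.next (LTL.neg (LTL.atom (Pi.single 0 1) c)))

/-- The formula says what it should about the actions. -/
theorem satisfies_eventuallyActionGt_iff (R : RNNCode) (c : ℝ) :
    R.system.Satisfies (eventuallyActionGt R.dim c) ↔
      ∀ π, R.system.IsPath π → (π 0).1 ∈ R.system.X₀ →
        (∀ i, (π 0).2 i ∈ R.system.H₀ i) →
        ∃ t, c < (R.system.action π t (0 : Fin 1)).1 (0 : Fin (R.dim + 1)) := by
  refine forall_congr' fun π => forall_congr' fun hπ => forall_congr' fun _ =>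
    forall_congr' fun _ => ?_
  have key : ∀ t, (π (t + 1)).1.1 = (R.system.action π t (0 : Fin 1)).1 := fun t => (hπ t).1
  simp only [eventuallyActionGt, LTL.SatAt, zero_add, not_le]
  refine exists_congr fun t => ?_
  rw [key t]
  have : (∑ j : Fin (R.dim + 1), (Pi.single 0 1 : Fin (R.dim + 1) → ℝ) j *
      (R.system.action π t (0 : Fin 1)).1 j) =
      (R.system.action π t (0 : Fin 1)).1 (0 : Fin (R.dim + 1)) := by
    rw [Finset.sum_eq_single 0]
    · simp
    · intro j _ hj
      simp [Pi.single_eq_of_ne hj]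
    · simp
  exact Eq.to_iff (congrArg (fun z => c < z) this)

end MNMASVerification

end

/-!
The halting problem is reduced to the behaviour of one fixed network, of which only the initial
hidden state depends on the instance. A program halts if and only if a certain primitive recursive
function of its number `n` and a bound `k` has a zero in `k`. Unbounded search for such a zero is a
counter program with `n` as its input, because counter programs compute all primitive recursive
functions (`Prog.computes_of_primrec`, `Prog.exists_search`). Executed with an explicit stack of
programs that are still to be run, a fixed program only meets finitely many stacks
(`Prog.exists_closed_finset`), so that it is a counter machine with finitely many control states.

ReLU networks simulate such machines with one network step per machine step. If `s` is the indicator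
of a control state, and `c` the value of the counter that is tested there, then `max 0 (s - c)`
indicates that the machine is in this state and finds the counter zero. From these indicators, the
indicators of all states, and the counters, the next configuration is obtained by a linear map with
integer coefficients, and the composition of this map with the linear forms under `max 0` is the
recurrent weight matrix (`CounterMachine.max_sum_weight`, `CounterMachine.exists_network`). The
unit for the halting state has values in `{0, 1}`, and with a suitable machine it is undecidable,
given the input, whether it ever takes the value `1` (`exists_undecidable_network`).

If this unit is the action of the network, then `◇ (a₁ > c)` holds for `0 < c < 1` if and only if
the machine halts (`IntNetwork.satisfies_rnnCode`). The graph of `y = max 0 z` is given by `0 ≤ y`,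
`z ≤ y`, and `y ≤ 0 ∨ y ≤ z`, so the same system has a linear description, which is computable from
the input (`IntNetwork.primrec_systemCode`), and the unbounded formula `◇ ¬ (x ≤ 1 / 2)` expresses
halting (`IntNetwork.satisfies_formula`).
-/

namespace MNMASVerification

open Function

/-! ### Counter machines -/

/-- A machine with control states `Q` and counters indexed by `ℕ`. In state `q` it looks at the
counter `reg q`. If this is zero, the counter is set to `setZero q` and the next state is
`ifZero q`; if it is positive, it is decremented, then increased by `addPos q`, and the next state
is `ifPos q`. -/
structure CounterMachine (Q : Type) where
  reg : Q → ℕ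
  ifZero : Q → Q
  ifPos : Q → Q
  setZero : Q → ℕ
  addPos : Q → ℕ

/-- One step of a counter machine on a control state and a store. -/
def CounterMachine.step {Q : Type} (M : CounterMachine Q) (c : Q × (ℕ → ℕ)) : Q × (ℕ → ℕ) :=
  if c.2 (M.reg c.1) = 0 then
    (M.ifZero c.1, update c.2 (M.reg c.1) (M.setZero c.1))
  else
    (M.ifPos c.1, update c.2 (M.reg c.1) (c.2 (M.reg c.1) - 1 + M.addPos c.1))

/-- The store whose counter `0` holds `n`, while the others are zero. -/
def input (n : ℕ) : ℕ → ℕ := update (fun _ => 0) 0 n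

/-! ### Structured counter programs -/

/-- Counter programs: increment, decrement, sequential composition, and the loop that repeats its
body while a counter is nonzero. -/
inductive Prog : Type
  | inc (r : ℕ)
  | dec (r : ℕ)
  | seq (P Q : Prog)
  | loop (r : ℕ) (P : Prog)

namespace Prog

/-- The counter machine that executes programs. Its control states are stacks of programs that
are still to be executed; the empty stack is the halting state. -/
def machine : CounterMachine (List Prog) where
  reg
    | inc r :: _ => r
    | dec r :: _ => r
    | loop r _ :: _ => r
    | _ => 0
  ifZero
    | seq P Q :: K => P :: Q :: K
    | K => K.tail
  ifPos
    | seq P Q :: K => P :: Q :: K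
    | loop r P :: K => P :: loop r P :: K
    | K => K.tail
  setZero
    | inc _ :: _ => 1
    | _ => 0
  addPos
    | inc _ :: _ => 2
    | dec _ :: _ => 0
    | _ => 1

theorem step_inc (r : ℕ) (K : List Prog) (s : ℕ → ℕ) :
    machine.step (inc r :: K, s) = (K, update s r (s r + 1)) := by
  by_cases h : s r = 0
  · simp [CounterMachine.step, machine, h]
  · have : s r - 1 + 2 = s r + 1 := by lia
    simp [CounterMachine.step, machine, h, this]

theorem step_dec (r : ℕ) (K : List Prog) (s : ℕ → ℕ) :
    machine.step (dec r :: K, s) = (K, update s r (s r - 1)) := by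
  by_cases h : s r = 0 <;> simp [CounterMachine.step, machine, h]

theorem update_zero_of_eq {r : ℕ} {s : ℕ → ℕ} (h : s r = 0) : update s r 0 = s := by
  rw [← h, update_eq_self]

theorem update_sub_add_self {r : ℕ} {s : ℕ → ℕ} (h : s r ≠ 0) :
    update s r (s r - 1 + 1) = s := by
  rw [Nat.sub_add_cancel (Nat.pos_of_ne_zero h), update_eq_self]

theorem step_seq (P Q : Prog) (K : List Prog) (s : ℕ → ℕ) :
    machine.step (seq P Q :: K, s) = (P :: Q :: K, s) := by
  by_cases h : s 0 = 0
  · simp [CounterMachine.step, machine, h, update_zero_of_eq]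
  · simp [CounterMachine.step, machine, h, update_sub_add_self]

theorem step_loop_zero (r : ℕ) (P : Prog) (K : List Prog) (s : ℕ → ℕ) (h : s r = 0) :
    machine.step (loop r P :: K, s) = (K, s) := by
  simp [CounterMachine.step, machine, h, update_zero_of_eq]

theorem step_loop_pos (r : ℕ) (P : Prog) (K : List Prog) (s : ℕ → ℕ) (h : s r ≠ 0) :
    machine.step (loop r P :: K, s) = (P :: loop r P :: K, s) := by
  simp [CounterMachine.step, machine, h, update_sub_add_self]

theorem step_nil (s : ℕ → ℕ) : machine.step ([], s) = ([], s) := by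
  by_cases h : s 0 = 0
  · simp [CounterMachine.step, machine, h, update_zero_of_eq]
  · simp [CounterMachine.step, machine, h, update_sub_add_self]

/-- `P` terminates from the store `s` with the store `s'`, whatever is to be executed next. At
least one step is taken. -/
def Exec (P : Prog) (s s' : ℕ → ℕ) : Prop :=
  ∀ K, ∃ n, machine.step^[n + 1] (P :: K, s) = (K, s')

theorem Exec.inc (r : ℕ) (s : ℕ → ℕ) : Exec (inc r) s (update s r (s r + 1)) :=
  fun K => ⟨0, step_inc r K s⟩

theorem Exec.dec (r : ℕ) (s : ℕ → ℕ) : Exec (dec r) s (update s r (s r - 1)) :=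
  fun K => ⟨0, step_dec r K s⟩

theorem Exec.seq {P Q : Prog} {s s' s'' : ℕ → ℕ} (hP : Exec P s s') (hQ : Exec Q s' s'') :
    Exec (seq P Q) s s'' := by
  intro K
  obtain ⟨m, hm⟩ := hP (Q :: K)
  obtain ⟨n, hn⟩ := hQ K
  refine ⟨n + 1 + (m + 1), ?_⟩
  rw [iterate_succ_apply, step_seq, iterate_add_apply, hm, hn]

theorem Exec.loop_zero {r : ℕ} {P : Prog} {s : ℕ → ℕ} (h : s r = 0) : Exec (loop r P) s s :=
  fun K => ⟨0, step_loop_zero r P K s h⟩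

theorem Exec.loop_pos {r : ℕ} {P : Prog} {s s' s'' : ℕ → ℕ} (h : s r ≠ 0) (hP : Exec P s s')
    (hl : Exec (loop r P) s' s'') : Exec (loop r P) s s'' := by
  intro K
  obtain ⟨m, hm⟩ := hP (loop r P :: K)
  obtain ⟨n, hn⟩ := hl K
  refine ⟨n + 1 + (m + 1), ?_⟩
  rw [iterate_succ_apply, step_loop_pos r P K s h, iterate_add_apply, hm, hn]

/-- Termination of a loop by a family of invariants `I m`, where `m` is the number of
remaining rounds. -/
theorem Exec.loop_of_invariant {r : ℕ} {P : Prog} (I : ℕ → (ℕ → ℕ) → Prop)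
    (h0 : ∀ s, I 0 s → s r = 0)
    (hs : ∀ m s, I (m + 1) s → s r ≠ 0 ∧ ∃ s', Exec P s s' ∧ I m s') :
    ∀ m s, I m s → ∃ s', Exec (loop r P) s s' ∧ I 0 s'
  | 0, s, h => ⟨s, .loop_zero (h0 s h), h⟩
  | m + 1, s, h => by
    obtain ⟨hr, s', hP, hI⟩ := hs m s h
    obtain ⟨s'', hl, hI'⟩ := Exec.loop_of_invariant I h0 hs m s' hI
    exact ⟨s'', .loop_pos hr hP hl, hI'⟩

/-- Set a counter to zero. -/
def clear (r : ℕ) : Prog := loop r (dec r)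

theorem exec_clear (r : ℕ) (s : ℕ → ℕ) : Exec (clear r) s (update s r 0) := by
  obtain ⟨s', h, h0, h1⟩ := Exec.loop_of_invariant (r := r) (P := dec r)
    (fun m s' => s' r = m ∧ ∀ j ≠ r, s' j = s j) (fun s' h => h.1)
    (fun m s' h => ⟨by lia, _, Exec.dec r s', by simp [h.1], fun j hj => by
      simp [update_of_ne hj, h.2 j hj]⟩) (s r) s ⟨rfl, fun _ _ => rfl⟩
  rwa [show update s r 0 = s' from update_eq_iff.2 ⟨h0.symm, fun j hj => (h1 j hj).symm⟩]

/-- Copy counter `a` to counter `b`, using counter `t` as auxiliary storage. -/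
def copy (a b t : ℕ) : Prog :=
  seq (clear b) (seq (clear t) (seq (loop a (seq (dec a) (seq (inc b) (inc t))))
    (loop t (seq (dec t) (inc a)))))

theorem exec_copy {a b t : ℕ} (hab : a ≠ b) (hat : a ≠ t) (hbt : b ≠ t) (s : ℕ → ℕ) :
    ∃ s', Exec (copy a b t) s s' ∧ s' b = s a ∧ ∀ j, j ≠ b → j ≠ t → s' j = s j := by
  obtain ⟨s₁, h₁, h₁a, h₁b, h₁t, h₁j⟩ := Exec.loop_of_invariant (r := a)
    (P := seq (dec a) (seq (inc b) (inc t)))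
    (fun m s' => s' a = m ∧ s' b + m = s a ∧ s' t + m = s a ∧
      ∀ j, j ≠ a → j ≠ b → j ≠ t → s' j = s j) (fun s' h => h.1)
    (fun m s' h => ⟨by lia, _, .seq (.dec a s') (.seq (.inc b _) (.inc t _)), by
      obtain ⟨ha, hb, ht, hj⟩ := h
      refine ⟨?_, ?_, ?_, fun j hja hjb hjt => ?_⟩ <;>
        simp [hab.symm, hat.symm, hbt.symm, *] <;> lia⟩)
    (s a) (update (update s b 0) t 0)
    (by simp +contextual [hab, hat, hbt])
  obtain ⟨s₂, h₂, h₂t, h₂a, h₂j⟩ := Exec.loop_of_invariant (r := t)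
    (P := seq (dec t) (inc a))
    (fun m s' => s' t = m ∧ s' a + m = s a ∧
      ∀ j, j ≠ a → j ≠ t → s' j = s₁ j) (fun s' h => h.1)
    (fun m s' h => ⟨by lia, _, .seq (.dec t s') (.inc a _), by
      obtain ⟨ht, ha, hj⟩ := h
      refine ⟨?_, ?_, fun j hja hjt => ?_⟩ <;>
        simp [hat.symm, *]
      lia⟩)
    (s a) s₁ ⟨by lia, by lia, fun _ _ _ => rfl⟩
  refine ⟨s₂, .seq (exec_clear b s) (.seq (exec_clear t _) (.seq h₁ h₂)), ?_, fun j hjb hjt => ?_⟩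
  · rw [h₂j b hab.symm hbt]; lia
  · by_cases hja : j = a
    · subst hja; lia
    · rw [h₂j j hja hjt, h₁j j hja hjb hjt]

/-! ### Primitive recursive functions as programs -/

/-- `f` can be computed by programs, with any choice of the counters `ins` for the arguments and
`out` for the value. Counters from `base` on are scratch space with arbitrary initial contents;
below `base`, only `out` is changed. -/
def Computes {n : ℕ} (f : List.Vector ℕ n → ℕ) : Prop :=
  ∀ (ins : Fin n → ℕ) (out base : ℕ), (∀ i, ins i < base) → (∀ i, ins i ≠ out) → out < base →
    ∃ P : Prog, ∀ s : ℕ → ℕ, ∃ s', Exec P s s' ∧ s' out = f (List.Vector.ofFn fun i => s (ins i)) ∧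
      ∀ j < base, j ≠ out → s' j = s j

theorem computes_zero : Computes (n := 0) fun _ => 0 := by
  intro ins out base _ _ _
  exact ⟨clear out, fun s => ⟨_, exec_clear out s, by simp, fun j _ hj => by simp [hj]⟩⟩

theorem computes_get {n : ℕ} (i : Fin n) : Computes fun v => v.get i := by
  intro ins out base hins hne hout
  refine ⟨copy (ins i) out base, fun s => ?_⟩
  obtain ⟨s', h, hb, hj⟩ := exec_copy (hne i) (hins i).ne hout.ne s
  exact ⟨s', h, by simpa using hb, fun j hjb hjo => hj j hjo hjb.ne⟩

theorem computes_succ : Computes (n := 1) fun v => v.head.succ := by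
  intro ins out base hins hne hout
  refine ⟨seq (copy (ins 0) out base) (inc out), fun s => ?_⟩
  obtain ⟨s', h, hb, hj⟩ := exec_copy (hne 0) (hins 0).ne hout.ne s
  refine ⟨_, h.seq (.inc out s'), by simp [hb, ← List.Vector.get_zero], fun j hjb hjo => ?_⟩
  simp [hjo, hj j hjo hjb.ne]

/-- The values of the inner functions are stored in the counters `base`, …, `base + n - 1`. -/
theorem Computes.comp {m n : ℕ} {f : List.Vector ℕ n → ℕ} (g : Fin n → List.Vector ℕ m → ℕ)
    (hf : Computes f) (hg : ∀ i, Computes (g i)) :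
    Computes fun v => f (List.Vector.ofFn fun i => g i v) := by
  intro ins out base hins hne hout
  have key : ∀ k ≤ n, ∃ P : Prog, ∀ s : ℕ → ℕ, ∃ s', Exec P s s' ∧
      (∀ i : Fin n, (i : ℕ) < k → s' (base + i) = g i (List.Vector.ofFn fun j => s (ins j))) ∧
      ∀ j < base, s' j = s j := by
    intro k
    induction k with
    | zero =>
      exact fun _ => ⟨inc base, fun s => ⟨_, .inc base s, fun i hi => absurd hi (by lia),
        fun j hj => by simp [hj.ne]⟩⟩
    | succ k ih =>
      intro hk
      obtain ⟨P, hP⟩ := ih (by lia)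
      obtain ⟨R, hR⟩ := hg ⟨k, hk⟩ ins (base + k) (base + n)
        (fun i => by have := hins i; lia) (fun i => by have := hins i; lia) (by lia)
      refine ⟨seq P R, fun s => ?_⟩
      obtain ⟨s₁, h₁, h₁g, h₁j⟩ := hP s
      obtain ⟨s₂, h₂, h₂o, h₂j⟩ := hR s₁
      refine ⟨s₂, h₁.seq h₂, fun i hi => ?_, fun j hj => ?_⟩
      · by_cases hik : (i : ℕ) = k
        · obtain rfl : i = ⟨k, hk⟩ := Fin.ext hik
          simp only [h₂o, h₁j _ (hins _)]
        · rw [h₂j _ (by lia) (by lia), h₁g i (by lia)]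
      · rw [h₂j j (by lia) (by lia), h₁j j hj]
  obtain ⟨P, hP⟩ := key n le_rfl
  obtain ⟨R, hR⟩ := hf (fun i => base + i) out (base + n) (fun i => by lia) (fun i => by lia)
    (by lia)
  refine ⟨seq P R, fun s => ?_⟩
  obtain ⟨s₁, h₁, h₁g, h₁j⟩ := hP s
  obtain ⟨s₂, h₂, h₂o, h₂j⟩ := hR s₁
  refine ⟨s₂, h₁.seq h₂, ?_, fun j hj hjo => ?_⟩
  · simp only [h₂o, h₁g _ (Fin.is_lt _)]
  · rw [h₂j j (by lia) hjo, h₁j j hj]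

theorem Computes.prec {n : ℕ} {f : List.Vector ℕ n → ℕ} {g : List.Vector ℕ (n + 2) → ℕ}
    (hf : Computes f) (hg : Computes g) :
    Computes (n := n + 1) fun v =>
      v.head.rec (f v.tail) fun y IH => g (y ::ᵥ IH ::ᵥ v.tail) := by
  intro ins out base hins hne hout
  -- `base` counts the finished rounds, `base + 1` the remaining ones, `base + 2` holds the value
  -- of the recursion so far, and `base + 3` receives its next value.
  obtain ⟨F, hF⟩ := hf (fun i => ins i.succ) (base + 2) (base + 4)
    (fun i => by have := hins i.succ; lia) (fun i => by have := hins i.succ; lia) (by lia)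
  obtain ⟨G, hG⟩ := hg (Fin.cons base (Fin.cons (base + 2) fun i => ins i.succ)) (base + 3)
    (base + 4)
    (Fin.cases (by simp) (Fin.cases (by simp) fun i => by
      have := hins i.succ
      simp only [Fin.cons_succ]; lia))
    (Fin.cases (by simp) (Fin.cases (by simp) fun i => by
      have := hins i.succ
      simp only [Fin.cons_succ]; lia))
    (by lia)
  refine ⟨seq F (seq (clear base) (seq (copy (ins 0) (base + 1) (base + 3)) (seq
    (loop (base + 1) (seq (dec (base + 1)) (seq G
      (seq (copy (base + 3) (base + 2) (base + 4)) (inc base)))))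
    (copy (base + 2) out (base + 3))))), fun s => ?_⟩
  set v : List.Vector ℕ n := List.Vector.ofFn fun i => s (ins i.succ) with hv
  let val : ℕ → ℕ := fun k => Nat.rec (f v) (fun y IH => g (y ::ᵥ IH ::ᵥ v)) k
  obtain ⟨s₁, h₁, h₁o, h₁j⟩ := hF s
  obtain ⟨s₂, h₂, h₂b, h₂j⟩ := exec_copy (a := ins 0) (b := base + 1) (t := base + 3)
    (by have := hins 0; lia) (by have := hins 0; lia) (by lia) (update s₁ base 0)
  obtain ⟨s₃, h₃, h₃0, h₃1, h₃2, h₃j⟩ := Exec.loop_of_invariant (r := base + 1)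
    (P := seq (dec (base + 1)) (seq G (seq (copy (base + 3) (base + 2) (base + 4)) (inc base))))
    (fun m s' => s' (base + 1) = m ∧ s' base + m = s (ins 0) ∧ s' (base + 2) = val (s' base) ∧
      ∀ j < base, s' j = s j) (fun s' h => h.1)
    (fun m s' h => by
      obtain ⟨hm, hy, hval, hj⟩ := h
      obtain ⟨t₁, e₁, e₁o, e₁j⟩ := hG (update s' (base + 1) (s' (base + 1) - 1))
      obtain ⟨t₂, e₂, e₂b, e₂j⟩ := exec_copy (a := base + 3) (b := base + 2) (t := base + 4)
        (by lia) (by lia) (by lia) t₁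
      refine ⟨by lia, _, .seq (.dec _ _) (.seq e₁ (.seq e₂ (.inc _ _))), ?_, ?_, ?_, ?_⟩
      · rw [update_of_ne (by lia), e₂j _ (by lia) (by lia), e₁j _ (by lia) (by lia),
          update_self, hm, Nat.add_sub_cancel]
      · rw [update_self, e₂j _ (by lia) (by lia), e₁j _ (by lia) (by lia),
          update_of_ne (by lia)]
        lia
      · rw [update_self, update_of_ne (by lia), e₂b, e₁o, e₂j _ (by lia) (by lia),
          e₁j _ (by lia) (by lia), update_of_ne (by lia)]
        change _ = g (s' base ::ᵥ val (s' base) ::ᵥ v)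
        have hne1 : ∀ i : Fin n, ins i.succ ≠ base + 1 := fun i => by
          have := hins i.succ; lia
        simp [List.Vector.ofFn, hval, hv, update_of_ne, hne1, hj _ (hins _)]
      · intro j hjb
        rw [update_of_ne (by lia), e₂j _ (by lia) (by lia), e₁j _ (by lia) (by lia),
          update_of_ne (by lia), hj j hjb])
    (s (ins 0)) s₂ (by
      refine ⟨?_, ?_, ?_, fun j hj => ?_⟩
      · have := hins 0
        rw [h₂b, update_of_ne (by lia), h₁j _ (by lia) (by lia)]
      · rw [h₂j _ (by lia) (by lia), update_self, Nat.zero_add]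
      · rw [h₂j _ (by lia) (by lia), update_of_ne (by lia), h₁o, h₂j _ (by lia) (by lia),
          update_self]
        rfl
      · rw [h₂j _ (by lia) (by lia), update_of_ne (by lia), h₁j _ (by lia) (by lia)])
  obtain ⟨s₄, h₄, h₄b, h₄j⟩ := exec_copy (a := base + 2) (b := out) (t := base + 3)
    (by lia) (by lia) (by lia) s₃
  refine ⟨s₄, .seq h₁ (.seq (exec_clear _ _) (.seq h₂ (.seq h₃ h₄))), ?_, fun j hj hjo => ?_⟩
  · rw [h₄b, h₃2, show s₃ base = s (ins 0) from h₃1]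
    simp [List.Vector.ofFn, val, hv]
  · rw [h₄j j hjo (by lia), h₃j j hj]

theorem computes_of_primrec {n : ℕ} {f : List.Vector ℕ n → ℕ} (hf : Nat.Primrec' f) :
    Computes f := by
  induction hf with
  | zero => exact computes_zero
  | succ => exact computes_succ
  | get i => exact computes_get i
  | comp g _ _ ihf ihg => exact ihf.comp g ihg
  | prec _ _ ihf ihg => exact ihf.prec ihg

/-! ### Unbounded search -/

/-- Unbounded search for a zero of a primitive recursive function is carried out by a counter
program. -/
theorem exists_search (g : ℕ → ℕ → ℕ) (hg : Primrec₂ g) :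
    ∃ P Q : Prog, ∀ n, (∃ T, (machine.step^[T] ([seq P Q], input n)).1 = []) ↔
      ∃ k, g n k = 0 := by
  obtain ⟨G, hG⟩ := computes_of_primrec (Nat.Primrec'.prim_iff₂.2 hg) (fun i => i) 2 3
    (by decide) (by decide) (by decide)
  -- Counter `0` holds `n`, counter `1` the candidate `k`, and counter `2` the value `g n k`.
  replace hG : ∀ s : ℕ → ℕ, ∃ s', Exec G s s' ∧ s' 2 = g (s 0) (s 1) ∧ s' 0 = s 0 ∧
      s' 1 = s 1 := fun s => by
    obtain ⟨s', h, h2, hj⟩ := hG s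
    exact ⟨s', h, by simpa [List.Vector.ofFn] using h2, hj 0 (by lia) (by lia),
      hj 1 (by lia) (by lia)⟩
  refine ⟨G, loop 2 (seq (inc 1) G), fun n => ⟨fun ⟨T, hT⟩ => ?_, fun h => ?_⟩⟩
  · by_contra! hne
    -- Without a zero, the loop is entered again at arbitrarily late times.
    have key : ∀ i, ∃ N, i ≤ N ∧ ∃ s : ℕ → ℕ, machine.step^[N] ([seq G (loop 2 (seq (inc 1) G))],
        input n) = ([loop 2 (seq (inc 1) G)], s) ∧ s 0 = n ∧ s 2 = g n (s 1) := by
      intro i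
      induction i with
      | zero =>
        obtain ⟨s', h, h2, h0, h1⟩ := hG (input n)
        obtain ⟨m, hm⟩ := h [loop 2 (seq (inc 1) G)]
        refine ⟨m + 1 + 1, by lia, s', by rw [iterate_succ_apply, step_seq, hm],
          by simp [h0, input], ?_⟩
        rw [h2, h1]
        simp [input]
      | succ i ih =>
        obtain ⟨N, hN, s, hs, hs0, hs2⟩ := ih
        obtain ⟨s', h, h2, h0, h1⟩ := hG (update s 1 (s 1 + 1))
        obtain ⟨m, hm⟩ := (Exec.inc 1 s).seq h [loop 2 (seq (inc 1) G)]
        refine ⟨m + 1 + 1 + N, by lia, s', ?_, by simp [h0, hs0], ?_⟩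
        · rw [iterate_add_apply, hs, iterate_succ_apply,
            step_loop_pos _ _ _ _ (by rw [hs2]; exact hne _), hm]
        · rw [h2, h1]
          simp [hs0]
    obtain ⟨N, hN, s, hs, -⟩ := key T
    obtain ⟨d, rfl⟩ := Nat.exists_eq_add_of_le' hN
    rw [iterate_add_apply, ← Prod.mk.eta (p := machine.step^[T] _), hT,
      iterate_fixed (step_nil _)] at hs
    simp at hs
  · classical
    have hmin : ∀ j < Nat.find h, g n j ≠ 0 := fun j hj => Nat.find_min h hj
    obtain ⟨s₁, h₁, h₁2, h₁0, h₁1⟩ := hG (input n)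
    obtain ⟨s₂, h₂, -⟩ := Exec.loop_of_invariant (r := 2) (P := seq (inc 1) G)
      (fun m s => s 0 = n ∧ s 1 + m = Nat.find h ∧ s 2 = g n (s 1))
      (fun s hs => by
        rw [hs.2.2, show s 1 = Nat.find h from hs.2.1]
        exact Nat.find_spec h)
      (fun m s hs => by
        obtain ⟨h0, h1, h2⟩ := hs
        refine ⟨by rw [h2]; exact hmin _ (by lia), ?_⟩
        obtain ⟨s', e, e2, e0, e1⟩ := hG (update s 1 (s 1 + 1))
        refine ⟨s', (Exec.inc 1 s).seq e, by simp [e0, h0], by simp [e1]; lia, ?_⟩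
        rw [e2, e1]
        simp [h0])
      (Nat.find h) s₁ (by simp [h₁0, h₁1, h₁2, input])
    obtain ⟨T, hT⟩ := h₁.seq h₂ []
    exact ⟨T + 1, by rw [hT]⟩

/-! ### The reachable stacks of a program -/

/-- The stacks that occur while `P` is executed on top of the stack `K`. -/
def residuals : Prog → List Prog → Set (List Prog)
  | inc r, K => {inc r :: K}
  | dec r, K => {dec r :: K}
  | seq P Q, K => {seq P Q :: K} ∪ residuals P (Q :: K) ∪ residuals Q K
  | loop r P, K => {loop r P :: K} ∪ residuals P (loop r P :: K)

theorem finite_residuals (P : Prog) (K : List Prog) : (residuals P K).Finite := by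
  induction P generalizing K with
  | inc r => exact Set.finite_singleton _
  | dec r => exact Set.finite_singleton _
  | seq P Q ihP ihQ => exact ((Set.finite_singleton _).union (ihP _)).union (ihQ _)
  | loop r P ih => exact (Set.finite_singleton _).union (ih _)

theorem cons_mem_residuals (P : Prog) (K : List Prog) : P :: K ∈ residuals P K := by
  cases P <;> simp [residuals]

theorem residuals_closed (P : Prog) (K : List Prog) :
    ∀ q ∈ residuals P K, (machine.ifZero q = K ∨ machine.ifZero q ∈ residuals P K) ∧
      (machine.ifPos q = K ∨ machine.ifPos q ∈ residuals P K) := by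
  induction P generalizing K with
  | inc r => rintro q rfl; exact ⟨.inl rfl, .inl rfl⟩
  | dec r => rintro q rfl; exact ⟨.inl rfl, .inl rfl⟩
  | seq P Q ihP ihQ =>
    have hP := cons_mem_residuals P (Q :: K)
    have hQ := cons_mem_residuals Q K
    rintro q ((rfl | hq) | hq)
    · exact ⟨.inr (.inl (.inr hP)), .inr (.inl (.inr hP))⟩
    · have := ihP _ q hq
      simp only [residuals, Set.mem_union]
      grind
    · have := ihQ _ q hq
      simp only [residuals, Set.mem_union]
      grind
  | loop r P ih =>
    have hP := cons_mem_residuals P (loop r P :: K)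
    rintro q (rfl | hq)
    · exact ⟨.inl rfl, .inr (.inr hP)⟩
    · have := ih _ q hq
      simp only [residuals, Set.mem_union, Set.mem_singleton_iff]
      grind

/-- The stacks that occur while `P` is executed lie in a finite set that is closed under the
transitions of the machine. -/
theorem exists_closed_finset (P : Prog) : ∃ F : Finset (List Prog), [] ∈ F ∧ [P] ∈ F ∧
    ∀ q ∈ F, machine.ifZero q ∈ F ∧ machine.ifPos q ∈ F := by
  classical
  refine ⟨insert [] (finite_residuals P []).toFinset, by simp, by simp [cons_mem_residuals], ?_⟩
  intro q hq
  simp only [Finset.mem_insert, Set.Finite.mem_toFinset] at hq ⊢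
  rcases hq with rfl | hq
  · exact ⟨.inl rfl, .inl rfl⟩
  · exact residuals_closed P [] q hq

end Prog

/-! ### Counter machines as recurrent ReLU networks -/

namespace CounterMachine

variable {Q : Type} [DecidableEq Q] (M : CounterMachine Q) (F : Finset Q) (N : ℕ)

/-- The neurons of the network that simulates a counter machine on the control states `F` and the
counters below `N`: for each control state one neuron that fires if this is the current state and
its counter is zero, and one that fires if it is the current state, and for each counter a neuron
with its value. -/
abbrev Neuron : Type := F ⊕ F ⊕ Fin N

variable {F N} in
/-- The coefficients with which the indicator of `p` being the next control state depends on the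
neurons. -/
def stateWeight (p : Q) : Neuron F N → ℤ
  | .inl q => (if M.ifZero q = p then 1 else 0) - (if M.ifPos q = p then 1 else 0)
  | .inr (.inl q) => if M.ifPos q = p then 1 else 0
  | .inr (.inr _) => 0

variable {F N} in
/-- The coefficients with which the next value of counter `j` depends on the neurons. -/
def counterWeight (j : ℕ) : Neuron F N → ℤ
  | .inl q => if M.reg q = j then M.setZero q - (M.addPos q - 1) else 0
  | .inr (.inl q) => if M.reg q = j then M.addPos q - 1 else 0
  | .inr (.inr i) => if (i : ℕ) = j then 1 else 0

variable {F N} in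
/-- The recurrent weights. The neuron that tests for state `q` and counter zero computes
`max 0 (s - c)` from the indicator `s` of the state and the value `c` of the counter. Since the
next configuration is a linear function of the neurons, one network step carries out one step of
the machine. -/
def weight : Neuron F N → Neuron F N → ℤ
  | .inl q => fun l => M.stateWeight q l - M.counterWeight (M.reg q) l
  | .inr (.inl q) => M.stateWeight q
  | .inr (.inr j) => M.counterWeight j

variable {F} in
/-- The values of the neurons in the control state `x` with the store `s`. -/
def activation (x : F) (s : ℕ → ℕ) : Neuron F N → ℝ
  | .inl q => if q = x ∧ s (M.reg x) = 0 then 1 else 0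
  | .inr (.inl q) => if q = x then 1 else 0
  | .inr (.inr j) => s j

variable {F N}

/-- The read-outs of the control states from a configuration describe the next control state. -/
theorem sum_stateWeight_activation (x : F) (s : ℕ → ℕ) (p : Q) :
    ∑ l, (M.stateWeight p l : ℝ) * M.activation N x s l =
      if (M.step (x, s)).1 = p then 1 else 0 := by
  by_cases h : s (M.reg x) = 0 <;>
    simp [Fintype.sum_sum_type, stateWeight, activation, step, h]

/-- The read-outs of the counters from a configuration are the next values of the counters. -/
theorem sum_counterWeight_activation (x : F) (s : ℕ → ℕ) (j : Fin N) :
    ∑ l, (M.counterWeight j l : ℝ) * M.activation N x s l = (M.step (x, s)).2 j := by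
  have hj : ∑ i : Fin N, (((if (i : ℕ) = j then 1 else 0 : ℤ) : ℝ)) * (s i : ℝ) = s j := by
    rw [Finset.sum_eq_single j] <;> simp +contextual [Fin.val_inj]
  by_cases h : s (M.reg x) = 0
  · by_cases hr : M.reg x = j
    · simp only [Fintype.sum_sum_type, counterWeight, activation, hj]
      simp [step, h, ← hr]
    · simp only [Fintype.sum_sum_type, counterWeight, activation, hj]
      simp [step, h, hr, update_of_ne (Ne.symm hr)]
  · by_cases hr : M.reg x = j
    · simp only [Fintype.sum_sum_type, counterWeight, activation, hj]
      have h1 : 1 ≤ s (M.reg x) := Nat.pos_of_ne_zero h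
      simp [step, h, ← hr, Nat.cast_sub h1]
      ring
    · simp only [Fintype.sum_sum_type, counterWeight, activation, hj]
      simp [step, h, hr, update_of_ne (Ne.symm hr)]

/-- If the linear read-outs of `y` describe a configuration, then one network step from `y` leads
to the neuron values of this configuration. -/
theorem max_sum_weight (hN : ∀ q ∈ F, M.reg q < N) (y : Neuron F N → ℝ) (x : F) (s : ℕ → ℕ)
    (hx : ∀ p : Q, ∑ l, (M.stateWeight p l : ℝ) * y l = if x = p then 1 else 0)
    (hs : ∀ j : Fin N, ∑ l, (M.counterWeight j l : ℝ) * y l = s j) (l : Neuron F N) :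
    max 0 (∑ k, (M.weight l k : ℝ) * y k) = M.activation N x s l := by
  rcases l with q | q | j
  · have h2 := hs ⟨M.reg q, hN q q.2⟩
    simp only [weight, Int.cast_sub, sub_mul, Finset.sum_sub_distrib, hx, activation] at h2 ⊢
    rw [h2]
    by_cases hq : q = x
    · subst hq
      by_cases h0 : s (M.reg q) = 0
      · simp [h0]
      · have : (1 : ℝ) ≤ s (M.reg q) := by exact_mod_cast Nat.pos_of_ne_zero h0
        simp [h0, this]
    · simp [hq, Ne.symm hq]
  · simp only [weight, hx, activation, Subtype.coe_inj, eq_comm (a := x)]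
    split_ifs <;> simp
  · simp [weight, hs, activation]

end CounterMachine

/-! ### Networks with a fixed weight matrix and one numerical input -/

/-- A recurrent ReLU network with integer weights and without bias, whose initial hidden state
has the entry `1` at `one`, a natural number as input at `inp`, and zeros elsewhere. The unit
`out` is its output. -/
structure IntNetwork where
  units : ℕ
  W : Fin units → Fin units → ℤ
  one : Fin units
  inp : Fin units
  out : Fin units

namespace IntNetwork

variable (R : IntNetwork)

/-- The initial hidden state on input `n`. -/
def start (n : ℕ) (i : Fin R.units) : ℕ :=
  if i = R.one then 1 else if i = R.inp then n else 0

/-- The next hidden state. -/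
def next (h : Fin R.units → ℝ) (i : Fin R.units) : ℝ :=
  max 0 (∑ j, (R.W i j : ℝ) * h j)

/-- The trajectory of the hidden state on input `n`. -/
def hidden (n t : ℕ) : Fin R.units → ℝ :=
  R.next^[t] fun i => (R.start n i : ℝ)

theorem hidden_succ (n t : ℕ) : R.hidden n (t + 1) = R.next (R.hidden n t) :=
  iterate_succ_apply' ..

/-- The value of the output unit after `t + 1` steps. This is the action at time `t`, since a
policy acts on its new hidden state. -/
def output (n t : ℕ) : ℝ :=
  R.hidden n (t + 1) R.out

end IntNetwork

/-- A counter machine whose states of interest lie in a finite closed set `F` is simulated by a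
network, whose output unit indicates the state `qf`. The first step of the machine must be
unconditional and must not change the store. -/
theorem CounterMachine.exists_network {Q : Type} (M : CounterMachine Q) (F : Finset Q)
    (hF : ∀ q ∈ F, M.ifZero q ∈ F ∧ M.ifPos q ∈ F) (q₀ qf : Q) (hq₀ : q₀ ∈ F) (hqf : qf ∈ F)
    (h₀ : M.addPos q₀ = 1) (h₁ : ∀ n, M.step (q₀, input n) = (M.ifPos q₀, input n)) :
    ∃ R : IntNetwork, ∀ n t,
      ((M.step^[t + 1] (q₀, input n)).1 = qf ∧ R.output n t = 1) ∨
      ((M.step^[t + 1] (q₀, input n)).1 ≠ qf ∧ R.output n t = 0) := by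
  classical
  obtain ⟨N, hN⟩ : ∃ N, ∀ q ∈ F, M.reg q < N + 1 :=
    ⟨F.sup M.reg, fun q hq => Nat.lt_succ_of_le (Finset.le_sup (f := M.reg) hq)⟩
  let e : Fin (Fintype.card (Neuron F (N + 1))) ≃ Neuron F (N + 1) :=
    (Fintype.equivFin _).symm
  let R : IntNetwork := {
    units := Fintype.card (Neuron F (N + 1))
    W := fun i j => M.weight (e i) (e j)
    one := e.symm (.inr (.inl ⟨q₀, hq₀⟩))
    inp := e.symm (.inr (.inr 0))
    out := e.symm (.inr (.inl ⟨qf, hqf⟩)) }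
  refine ⟨R, fun n => ?_⟩
  have hstep : ∀ c : Q × (ℕ → ℕ), c.1 ∈ F → (M.step c).1 ∈ F := fun c hc => by
    unfold CounterMachine.step
    split_ifs
    exacts [(hF _ hc).1, (hF _ hc).2]
  have hnext : ∀ (y : Neuron F (N + 1) → ℝ) (c : Q × (ℕ → ℕ)) (hc : c.1 ∈ F),
      (∀ p : Q, ∑ l, (M.stateWeight p l : ℝ) * y l = if c.1 = p then 1 else 0) →
      (∀ j : Fin (N + 1), ∑ l, (M.counterWeight j l : ℝ) * y l = c.2 j) →
      R.next (y ∘ e) = M.activation (N + 1) ⟨c.1, hc⟩ c.2 ∘ e := fun y c hc h1 h2 => by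
    funext i
    simp only [IntNetwork.next, comp_apply, R]
    rw [e.sum_comp (fun l => (M.weight (e i) l : ℝ) * y l)]
    exact M.max_sum_weight hN y ⟨c.1, hc⟩ c.2 h1 h2 (e i)
  have key : ∀ t, ∃ hc : (M.step^[t + 1] (q₀, input n)).1 ∈ F,
      R.next^[t + 1] (fun i => (R.start n i : ℝ)) =
        M.activation (N + 1) ⟨_, hc⟩ (M.step^[t + 1] (q₀, input n)).2 ∘ e := by
    intro t
    induction t with
    | zero =>
      refine ⟨hstep _ hq₀, ?_⟩
      -- The initial hidden state is not the activation of any configuration: it only has to have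
      -- the read-outs of the configuration after the first, unconditional step. This keeps it
      -- linear in the input.
      let y : Neuron F (N + 1) → ℝ
        | .inl _ => 0
        | .inr (.inl q) => if q = ⟨q₀, hq₀⟩ then 1 else 0
        | .inr (.inr j) => if j = 0 then n else 0
      have hy : (fun i => (R.start n i : ℝ)) = y ∘ e := by
        funext i
        simp only [IntNetwork.start, R, Equiv.eq_symm_apply, comp_apply]
        rcases e i with q | q | j <;> simp [y]
      rw [hy]
      refine hnext y _ _ (fun p => ?_) (fun j => ?_)
      · simp [h₁, Fintype.sum_sum_type, stateWeight, y]
      · simp only [iterate_succ, iterate_zero, comp_apply, id, h₁]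
        by_cases hj : j = 0
        · subst hj
          simp [Fintype.sum_sum_type, counterWeight, y, h₀, input]
        · have : (0 : ℕ) ≠ j := fun h => hj (Fin.ext h.symm)
          simp [Fintype.sum_sum_type, counterWeight, y, h₀, this, this.symm, input]
    | succ t ih =>
      obtain ⟨hc, ih⟩ := ih
      rw [iterate_succ_apply' R.next, ih]
      generalize hd : M.step^[t + 1] (q₀, input n) = d at hc
      have hd' : M.step^[t + 1 + 1] (q₀, input n) = M.step d := by
        rw [iterate_succ_apply', hd]
      rw [hd']
      exact ⟨hstep d hc, hnext _ _ (hstep d hc)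
        (M.sum_stateWeight_activation ⟨d.1, hc⟩ d.2)
        (M.sum_counterWeight_activation ⟨d.1, hc⟩ d.2)⟩
  intro t
  obtain ⟨hc, h⟩ := key t
  have hout : R.output n t = if (M.step^[t + 1] (q₀, input n)).1 = qf then 1 else 0 := by
    simp [IntNetwork.output, IntNetwork.hidden, h, R, activation, eq_comm]
  rw [hout]
  split_ifs with hq
  exacts [.inl ⟨hq, rfl⟩, .inr ⟨hq, rfl⟩]

/-- For a primitive recursive `g`, one network semidecides on input `n` whether `g n` has a
zero. -/
theorem exists_network_search (g : ℕ → ℕ → ℕ) (hg : Primrec₂ g) :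
    ∃ R : IntNetwork, (∀ n t, R.output n t = 0 ∨ R.output n t = 1) ∧
      ∀ n, (∃ t, R.output n t = 1) ↔ ∃ k, g n k = 0 := by
  obtain ⟨P, P', hP⟩ := Prog.exists_search g hg
  obtain ⟨F, hnil, hmem, hF⟩ := Prog.exists_closed_finset (.seq P P')
  obtain ⟨R, hR⟩ := Prog.machine.exists_network F hF [.seq P P'] [] hmem hnil rfl
    fun n => Prog.step_seq P P' [] _
  refine ⟨R, fun n t => (hR n t).symm.imp And.right And.right, fun n => ?_⟩
  rw [← hP]
  constructor
  · rintro ⟨t, ht⟩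
    exact ⟨t + 1, ((hR n t).resolve_right fun h => by simp [ht] at h).1⟩
  · rintro ⟨_ | t, hT⟩
    · simp at hT
    · exact ⟨t, ((hR n t).resolve_right fun h => h.1 hT).2⟩

open Nat.Partrec in
/-- There is a network for which it is undecidable, given its input, whether its output unit ever
takes the value `1`; otherwise this unit has the value `0`. -/
theorem exists_undecidable_network :
    ∃ R : IntNetwork, (∀ n t, R.output n t = 0 ∨ R.output n t = 1) ∧
      ¬ ComputablePred fun n => ∃ t, R.output n t = 1 := by
  -- `g n k = 0` if the program with number `n` halts on input `0` within the bound `k`.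
  let g : ℕ → ℕ → ℕ := fun n k =>
    Option.casesOn (Code.evaln k (Denumerable.ofNat Code n) 0) 1 fun _ => 0
  have hg : Primrec₂ g := by
    refine Primrec.option_casesOn (Code.primrec_evaln.comp (.pair (.pair .snd
      ((Primrec.ofNat Code).comp .fst)) (.const 0))) (.const 1) (.const 0)
  obtain ⟨R, hR, hRg⟩ := exists_network_search g hg
  refine ⟨R, hR, fun h => ComputablePred.halting_problem 0 ?_⟩
  obtain ⟨D, hD⟩ := h
  have : ComputablePred fun c : Code => ∃ t, R.output (Encodable.encode c) t = 1 :=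
    ⟨fun _ => inferInstance, hD.comp Computable.encode⟩
  refine this.of_eq fun c => ?_
  rw [hRg, Part.dom_iff_mem]
  simp only [Code.evaln_complete, g, Denumerable.ofNat_encode]
  rw [exists_comm]
  refine exists_congr fun k => ?_
  cases Code.evaln k c 0 <;> simp

/-! ### Codes of integers -/

theorem RatCode.val_int (z : ℤ) : RatCode.val (z, 0) = z := by
  simp [RatCode.val]

theorem primrec_natCast_int : Primrec fun n : ℕ => (n : ℤ) := by
  refine Primrec.encode_iff.1 ((Primrec.nat_mul.comp (.const 2) .id).of_eq fun n => ?_)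
  change _ = uncurry Nat.bit (false, n)
  simp

theorem primrec_neg_natCast_int : Primrec fun n : ℕ => -(n : ℤ) := by
  refine Primrec.encode_iff.1 ((Primrec.nat_sub.comp
    (Primrec.nat_mul.comp (.const 2) .id) (.const 1)).of_eq fun n => ?_)
  change _ = Equiv.intEquivNat (-(n : ℤ))
  cases n with
  | zero => rfl
  | succ n =>
    have : -((n + 1 : ℕ) : ℤ) = Int.negSucc n := rfl
    rw [this]
    simp [Equiv.intEquivNat, Equiv.intEquivNatSumNat, Equiv.natSumNatEquivNat, Nat.mul_add]

theorem IntNetwork.primrec_start (R : IntNetwork) (i : Fin R.units) :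
    Primrec fun n => R.start n i := by
  unfold IntNetwork.start
  split_ifs
  exacts [.const 1, .id, .const 0]

/-! ### The fully observable system of a network -/

theorem vecOf_ofFn (k : ℕ) (f : Fin k → RatCode) :
    vecOf k (List.ofFn f) = fun i => RatCode.val (f i) := by
  funext i
  simp [vecOf, List.getD_eq_getElem?_getD]

theorem vecOf_nil (k : ℕ) : vecOf k [] = 0 := by
  funext i
  simp [vecOf, RatCode.val]

theorem matOf_ofFn (k l : ℕ) (f : Fin k → List RatCode) :
    matOf k l (List.ofFn f) = fun i => vecOf l (f i) := by
  funext i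
  simp [matOf, List.getD_eq_getElem?_getD]

theorem matOf_nil (k l : ℕ) : matOf k l [] = 0 := by
  funext i
  exact vecOf_nil l

/-- The description of the network as a policy with one input, which is ignored, and the output
unit as its one output. -/
def IntNetwork.rnnCode (R : IntNetwork) (n : ℕ) : RNNCode where
  dim := 0
  units := R.units
  W := List.ofFn fun i => List.ofFn fun j => (R.W i j, 0)
  U := []
  b := []
  V := List.ofFn fun _ : Fin 1 =>
    List.ofFn fun j => ((Pi.single R.out 1 : Fin R.units → ℤ) j, 0)
  d := []
  h₀ := List.ofFn fun i => ((R.start n i : ℤ), 0)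
  x₀ := []

theorem IntNetwork.primrec_rnnCode (R : IntNetwork) : Primrec R.rnnCode := by
  refine (Primrec.of_equiv_iff RNNCode.equiv).1 ?_
  have h : Primrec fun n => List.ofFn fun i => ((R.start n i : ℤ), (0 : ℕ)) :=
    Primrec.list_ofFn fun i => .pair (primrec_natCast_int.comp (R.primrec_start i)) (.const 0)
  exact .pair (.const _) <| .pair (.const _) <| .pair (.const _) <| .pair (.const _) <|
    .pair (.const _) <| .pair (.const _) <| .pair (.const _) <| .pair h (.const _)

/-- The network that `rnnCode` describes. -/
noncomputable def IntNetwork.rnn (R : IntNetwork) (n : ℕ) : RNN 1 R.units where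
  W i j := R.W i j
  U := 0
  b := 0
  V _ j := ((Pi.single R.out 1 : Fin R.units → ℤ) j : ℝ)
  d := 0
  h₀ := R.hidden n 0

theorem IntNetwork.rnnCode_rnn (R : IntNetwork) (n : ℕ) : (R.rnnCode n).rnn = R.rnn n := by
  change RNN.mk (matOf R.units R.units _) (matOf R.units 1 []) (vecOf R.units [])
    (matOf 1 R.units _) (vecOf 1 []) (vecOf R.units _) = RNN.mk _ _ _ _ _ _
  simp only [IntNetwork.rnnCode, matOf_ofFn, vecOf_ofFn, matOf_nil, vecOf_nil, RatCode.val_int]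
  rfl

theorem IntNetwork.rnn_hidden (R : IntNetwork) (n : ℕ) (o : Fin 1 → ℝ) (h : Fin R.units → ℝ) :
    (R.rnn n).hidden o h = R.next h := by
  funext i
  simp [RNN.hidden, IntNetwork.rnn, IntNetwork.next, Matrix.mulVec, dotProduct]

theorem IntNetwork.rnn_output (R : IntNetwork) (n : ℕ) (o : Fin 1 → ℝ) (h : Fin R.units → ℝ) :
    (R.rnn n).output o h = fun _ => R.next h R.out := by
  funext i
  rw [RNN.output, R.rnn_hidden n o h]
  simp [IntNetwork.rnn, Matrix.mulVec, dotProduct, Pi.single_apply]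

theorem satAt_eventuallyActionGt (x : ℕ → Fin 1 → ℝ) (c : ℝ) :
    LTL.SatAt x 0 (eventuallyActionGt 0 c) ↔ ∃ t, c < x (t + 1) 0 := by
  simp [eventuallyActionGt, LTL.SatAt]

/-- As the output unit is `0` or `1`, it exceeds `c` only where it is `1`. For the direction from
left to right, the path of the system has to be exhibited. -/
theorem IntNetwork.satisfies_rnn (R : IntNetwork)
    (hR : ∀ n t, R.output n t = 0 ∨ R.output n t = 1) {c : ℝ} (hc₀ : 0 < c) (hc₁ : c < 1)
    (n : ℕ) :
    ((R.rnn n).system 0).Satisfies (eventuallyActionGt 0 c) ↔ ∃ t, R.output n t = 1 := by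
  constructor
  · intro h
    -- The path of the system, which is determined by its initial state.
    let x : ℕ → Fin 1 → ℝ := fun t _ => t.casesOn 0 fun t => R.output n t
    let π : ℕ → ((R.rnn n).system 0).X × (∀ i, ((R.rnn n).system 0).H i) := fun t =>
      (⟨x t, trivial⟩, fun _ => ⟨R.hidden n t, trivial⟩)
    have hπ : ((R.rnn n).system 0).IsPath π := fun t =>
      ⟨Eq.trans (by rw [← R.hidden_succ]; rfl) (R.rnn_output n (x t) (R.hidden n t)).symm,
        fun _ => Subtype.ext
          ((R.hidden_succ n t).trans (R.rnn_hidden n (x t) (R.hidden n t)).symm)⟩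
    obtain ⟨t, ht⟩ := (satAt_eventuallyActionGt x c).1 (h π hπ rfl fun _ => rfl)
    refine ⟨t, (hR n t).resolve_left fun h0 => ?_⟩
    have : c < R.output n t := ht
    exact absurd (this.trans_eq h0) hc₀.not_gt
  · rintro ⟨t, ht⟩ π hπ - hh₀
    have hh : ∀ t, ((π t).2 (0 : Fin 1)).1 = R.hidden n t := by
      intro t
      induction t with
      | zero => exact hh₀ (0 : Fin 1)
      | succ t ih =>
        rw [(hπ t).2 (0 : Fin 1), R.hidden_succ, ← ih]
        exact R.rnn_hidden n _ _
    refine (satAt_eventuallyActionGt _ c).2 ⟨t, ?_⟩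
    have h1 : (π (t + 1)).1.1 = fun _ => R.next (R.hidden n t) R.out := by
      rw [← hh t]
      exact (hπ t).1.trans (R.rnn_output n _ _)
    have h2 : R.next (R.hidden n t) R.out = 1 := by
      rw [← R.hidden_succ]
      exact ht
    change c < (π (t + 1)).1.1 (0 : Fin 1)
    rw [h1, h2]
    exact hc₁

theorem IntNetwork.satisfies_rnnCode (R : IntNetwork)
    (hR : ∀ n t, R.output n t = 0 ∨ R.output n t = 1) {c : ℝ} (hc₀ : 0 < c) (hc₁ : c < 1)
    (n : ℕ) :
    (R.rnnCode n).system.Satisfies (eventuallyActionGt (R.rnnCode n).dim c) ↔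
      ∃ t, R.output n t = 1 := by
  -- The description has dimensions that are only definitionally those of `R.rnn n`, so the
  -- network is generalized before it is replaced.
  have key : ∀ (N : RNN 1 R.units) (x₀ : Fin 1 → ℝ), N = R.rnn n → x₀ = 0 →
      ((N.system x₀).Satisfies (eventuallyActionGt 0 c) ↔ ∃ t, R.output n t = 1) := by
    rintro _ _ rfl rfl
    exact R.satisfies_rnn hR hc₀ hc₁ n
  exact key _ _ (R.rnnCode_rnn n) (vecOf_nil 1)

/-! ### A linearly defined system with a network as its agent -/

/-- The linear form with coefficients `c` at `v`. -/
def linForm (c : List ℤ) (v : List ℝ) : ℝ :=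
  (List.zipWith (fun (q : ℤ) y => (q : ℝ) * y) c v).sum

theorem linForm_append {c c' : List ℤ} {v v' : List ℝ} (h : c.length = v.length) :
    linForm (c ++ c') (v ++ v') = linForm c v + linForm c' v' := by
  simp [linForm, List.zipWith_append h]

theorem linForm_ofFn {k : ℕ} (c : Fin k → ℤ) (v : Fin k → ℝ) :
    linForm (List.ofFn c) (List.ofFn v) = ∑ i, (c i : ℝ) * v i := by
  induction k with
  | zero => simp [linForm]
  | succ k ih =>
    have := ih (fun i => c i.succ) (fun i => v i.succ)
    rw [Fin.sum_univ_succ, ← this]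
    simp [linForm, List.ofFn_succ]

/-- The inequality `c · v ≤ d` with integer coefficients. -/
def ineq (c : List ℤ) (d : ℤ) : IneqCode := (c.map fun z => (z, 0), (d, 0))

theorem ineq_holds (c : List ℤ) (d : ℤ) (v : List ℝ) :
    IneqCode.Holds (ineq c d) v ↔ linForm c v ≤ d := by
  simp only [IneqCode.Holds, ineq, RatCode.val_int, linForm, List.zipWith_map_left]

theorem ConstraintCode.holds_pair (e f : IneqCode) (v : List ℝ) :
    ConstraintCode.Holds [[e], [f]] v ↔ IneqCode.Holds e v ∧ IneqCode.Holds f v := by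
  simp only [ConstraintCode.Holds, List.mem_cons, List.not_mem_nil, or_false, forall_eq_or_imp,
    forall_eq, exists_eq_left]

theorem ConstraintCode.holds_append (C D : ConstraintCode) (v : List ℝ) :
    ConstraintCode.Holds (C ++ D) v ↔ ConstraintCode.Holds C v ∧ ConstraintCode.Holds D v := by
  simp [ConstraintCode.Holds, or_imp, forall_and]

theorem ConstraintCode.holds_flatten_ofFn {k : ℕ} (C : Fin k → ConstraintCode) (v : List ℝ) :
    ConstraintCode.Holds (List.ofFn C).flatten v ↔ ∀ i, ConstraintCode.Holds (C i) v := by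
  simp only [ConstraintCode.Holds, List.mem_flatten, List.mem_ofFn]
  exact ⟨fun h i D hD => h D ⟨_, ⟨i, rfl⟩, hD⟩, fun h D ⟨_, ⟨i, hi⟩, hD⟩ => h i D (hi ▸ hD)⟩

theorem mem_set_nil {k : ℕ} (v : Fin k → ℝ) : v ∈ ConstraintCode.set [] k := by
  simp [ConstraintCode.set, ConstraintCode.Holds]

namespace IntNetwork

variable (R : IntNetwork)

/-- The coefficients of a linear form in an observation, a hidden state, an action, and a new
hidden state. The observation does not occur in it. -/
def row (β : Fin R.units → ℤ) (γ : Fin 1 → ℤ) (δ : Fin R.units → ℤ) : List ℤ :=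
  List.ofFn (0 : Fin 1 → ℤ) ++ List.ofFn β ++ List.ofFn γ ++ List.ofFn δ

theorem linForm_row (β : Fin R.units → ℤ) (γ : Fin 1 → ℤ) (δ : Fin R.units → ℤ)
    (o : Fin 1 → ℝ) (h : Fin R.units → ℝ) (u : Fin 1 → ℝ) (h' : Fin R.units → ℝ) :
    linForm (R.row β γ δ) (List.ofFn o ++ List.ofFn h ++ List.ofFn u ++ List.ofFn h') =
      ∑ j, (β j : ℝ) * h j + γ 0 * u 0 + ∑ j, (δ j : ℝ) * h' j := by
  rw [row, linForm_append (by simp), linForm_append (by simp), linForm_append (by simp)]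
  simp only [linForm_ofFn]
  simp

/-- The constraint that the action is the new value of the output unit. -/
def actionConstraint : ConstraintCode :=
  [[ineq (R.row 0 1 (-Pi.single R.out 1)) 0], [ineq (R.row 0 (-1) (Pi.single R.out 1)) 0]]

/-- The constraint that the new value `y` of unit `i` is `max 0 z`, where `z` is a linear form in
the hidden state: `0 ≤ y`, `z ≤ y`, and `y ≤ 0` or `y ≤ z`. -/
def unitConstraint (i : Fin R.units) : ConstraintCode :=
  [[ineq (R.row 0 0 (-Pi.single i 1)) 0], [ineq (R.row (R.W i) 0 (-Pi.single i 1)) 0],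
    [ineq (R.row 0 0 (Pi.single i 1)) 0, ineq (R.row (-R.W i) 0 (Pi.single i 1)) 0]]

/-- The constraint that the hidden state is the initial one on input `n`. -/
def startConstraint (n : ℕ) : ConstraintCode :=
  (List.ofFn fun i => [[ineq (List.ofFn (Pi.single i 1)) (R.start n i)],
    [ineq (List.ofFn (-Pi.single i 1)) (-(R.start n i : ℤ))]]).flatten

/-- The network as an agent with one observation, which is ignored, and the output unit as its
action. -/
def agentCode (n : ℕ) : AgentCode where
  obsDim := 1
  actDim := 1
  hidDim := R.units
  O := []
  A := []
  H := []
  H₀ := R.startConstraint n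
  obs := [[ineq [1, -1] 0], [ineq [-1, 1] 0]]
  r := R.actionConstraint ++ (List.ofFn R.unitConstraint).flatten

/-- The fully observable system with the network as its only agent, in which the next state is
the action. -/
def systemCode (n : ℕ) : SystemCode where
  stateDim := 1
  X := []
  X₀ := [[ineq [1] 0], [ineq [-1] 0]]
  τ := [[ineq [0, 1, -1] 0], [ineq [0, -1, 1] 0]]
  agents := [R.agentCode n]

theorem primrec_systemCode : Primrec R.systemCode := by
  refine (Primrec.of_equiv_iff SystemCode.equiv).1 ?_
  have hsingle : ∀ (l : List ℤ) (f : ℕ → ℤ), Primrec f → Primrec fun n => [ineq l (f n)] :=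
    fun l f hf => Primrec.list_cons.comp (.pair (.const _) (.pair hf (.const 0))) (.const [])
  have h : Primrec R.startConstraint :=
    Primrec.list_flatten.comp <| Primrec.list_ofFn fun i =>
      Primrec.list_cons.comp (hsingle _ _ (primrec_natCast_int.comp (R.primrec_start i))) <|
      Primrec.list_cons.comp (hsingle _ _ (primrec_neg_natCast_int.comp (R.primrec_start i)))
        (.const [])
  have ha : Primrec R.agentCode := by
    refine (Primrec.of_equiv_iff AgentCode.equiv).1 ?_
    exact .pair (.const _) <| .pair (.const _) <| .pair (.const _) <| .pair (.const _) <|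
      .pair (.const _) <| .pair (.const _) <| .pair h (.const (_, _))
  exact .pair (.const _) <| .pair (.const _) <| .pair (.const _) <| .pair (.const _) <|
    Primrec.list_cons.comp ha (.const [])

theorem holds_startConstraint (n : ℕ) (h : Fin R.units → ℝ) :
    ConstraintCode.Holds (R.startConstraint n) (List.ofFn h) ↔ h = R.hidden n 0 := by
  rw [startConstraint, ConstraintCode.holds_flatten_ofFn, funext_iff]
  refine forall_congr' fun i => ?_
  change _ ↔ h i = (R.start n i : ℝ)
  simp [ConstraintCode.holds_pair, ineq_holds, linForm_ofFn, Pi.single_apply,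
    le_antisymm_iff (a := h i)]

theorem obsRel_agentCode (n : ℕ) (x o : Fin 1 → ℝ) : (R.agentCode n).ObsRel x o ↔ o = x := by
  rw [funext_iff, Fin.forall_fin_one]
  simp only [AgentCode.ObsRel, agentCode, ConstraintCode.holds_pair, ineq_holds]
  simp [linForm, le_antisymm_iff, and_comm]

/-- The policy constraint of the agent is the graph of the network. -/
theorem policyRel_agentCode (n : ℕ) (o : Fin 1 → ℝ) (h : Fin R.units → ℝ) (u : Fin 1 → ℝ)
    (h' : Fin R.units → ℝ) :
    (R.agentCode n).PolicyRel o h u h' ↔ (u = fun _ => R.next h R.out) ∧ h' = R.next h := by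
  have hsum : ∀ i, ∑ j, ((Pi.single i 1 : Fin R.units → ℤ) j : ℝ) * h' j = h' i := fun i => by
    rw [Finset.sum_eq_single i] <;> simp +contextual
  have hact : ConstraintCode.Holds R.actionConstraint
      (List.ofFn o ++ List.ofFn h ++ List.ofFn u ++ List.ofFn h') ↔ u 0 = h' R.out := by
    simp only [actionConstraint, ConstraintCode.holds_pair, ineq_holds, linForm_row]
    simp [hsum, le_antisymm_iff]
  have hunit : ∀ i, ConstraintCode.Holds (R.unitConstraint i)
      (List.ofFn o ++ List.ofFn h ++ List.ofFn u ++ List.ofFn h') ↔ h' i = R.next h i := by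
    intro i
    simp only [unitConstraint, ConstraintCode.Holds, List.mem_cons, List.not_mem_nil,
      or_false, forall_eq_or_imp, forall_eq, exists_eq_or_imp, exists_eq_left, ineq_holds,
      linForm_row]
    simp only [Pi.zero_apply, Pi.neg_apply, Int.cast_zero, Int.cast_neg, zero_mul, neg_mul,
      Finset.sum_const_zero, Finset.sum_neg_distrib, hsum, zero_add, add_zero, next]
    constructor
    · rintro ⟨h1, h2, h3⟩
      refine le_antisymm (le_max_iff.2 (h3.imp id fun h3 => by linarith))
        (max_le (by linarith) (by linarith))
    · intro heq
      rw [heq]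
      refine ⟨by simp, by linarith [le_max_right 0 (∑ j, (R.W i j : ℝ) * h j)], ?_⟩
      rcases le_total 0 (∑ j, (R.W i j : ℝ) * h j) with h0 | h0 <;> simp [h0]
  have hrel : (R.agentCode n).PolicyRel o h u h' ↔ u 0 = h' R.out ∧ ∀ i, h' i = R.next h i := by
    rw [← hact, ← forall_congr' hunit, ← ConstraintCode.holds_flatten_ofFn,
      ← ConstraintCode.holds_append]
    rfl
  rw [hrel, ← funext_iff]
  constructor
  · rintro ⟨hu, rfl⟩
    exact ⟨funext fun i => by rw [Subsingleton.elim i 0, hu], rfl⟩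
  · rintro ⟨rfl, rfl⟩
    exact ⟨rfl, rfl⟩

theorem systemCode_valid (n : ℕ) : (R.systemCode n).Valid where
  obs i x := by
    obtain rfl : i = (0 : Fin 1) := Subsingleton.elim (α := Fin 1) _ _
    exact ⟨⟨x.1, mem_set_nil _⟩, (R.obsRel_agentCode n x.1 x.1).2 rfl,
      fun o ho => Subtype.ext ((R.obsRel_agentCode n x.1 o.1).1 ho)⟩
  r i o h := by
    obtain rfl : i = (0 : Fin 1) := Subsingleton.elim (α := Fin 1) _ _
    refine ⟨(⟨fun _ => R.next h.1 R.out, mem_set_nil _⟩, ⟨R.next h.1, mem_set_nil _⟩),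
      (R.policyRel_agentCode n o.1 h.1 _ _).2 ⟨rfl, rfl⟩, fun p hp => ?_⟩
    obtain ⟨h1, h2⟩ := (R.policyRel_agentCode n o.1 h.1 _ _).1 hp
    exact Prod.ext (Subtype.ext h1) (Subtype.ext h2)

/-- The system described by `systemCode`. -/
noncomputable abbrev system (n : ℕ) : MNMAS := (R.systemCode n).system (R.systemCode_valid n)

theorem system_r (n : ℕ) (o : (R.system n).O (0 : Fin 1)) (h : (R.system n).H (0 : Fin 1)) :
    (((R.system n).r (0 : Fin 1) o h).1.1 = fun _ => R.next h.1 R.out) ∧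
      ((R.system n).r (0 : Fin 1) o h).2.1 = R.next h.1 :=
  (R.policyRel_agentCode n o.1 h.1 _ _).1
    ((R.systemCode_valid n).r (0 : Fin 1) o h).choose_spec.1

theorem mem_system_τ (n : ℕ) (x x' : (R.system n).X) (a : ∀ i, (R.system n).A i) :
    x' ∈ (R.system n).τ x a ↔ x'.1 = (a (0 : Fin 1)).1 := by
  have hx : x'.1 = (a (0 : Fin 1)).1 ↔ x'.1 (0 : Fin 1) = (a (0 : Fin 1)).1 (0 : Fin 1) :=
    funext_iff.trans Fin.forall_fin_one
  rw [hx]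
  change ConstraintCode.Holds [[ineq [0, 1, -1] 0], [ineq [0, -1, 1] 0]]
    [x.1 (0 : Fin 1), (a (0 : Fin 1)).1 (0 : Fin 1), x'.1 (0 : Fin 1)] ↔ _
  simp only [ConstraintCode.holds_pair, ineq_holds]
  simp [linForm, le_antisymm_iff, and_comm]

/-- The formula `◇ ¬ (x ≤ 1 / 2)`. -/
def formula : LTL RatCode 1 := .eventually (.neg (.atom (fun _ => (1, 0)) (1, 1)))

theorem satAt_formula (x : ℕ → Fin 1 → ℝ) :
    LTL.SatAt x 0 (formula.map RatCode.val) ↔ ∃ t, 1 / 2 < x t 0 := by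
  simp only [formula, LTL.map, LTL.SatAt, zero_add, not_le]
  norm_num [RatCode.val]

theorem satisfies_formula (hR : ∀ n t, R.output n t = 0 ∨ R.output n t = 1) (n : ℕ) :
    (R.system n).Satisfies (formula.map RatCode.val) ↔ ∃ t, R.output n t = 1 := by
  constructor
  · intro h
    -- The path of the system, which is determined by its initial state.
    let x : ℕ → Fin 1 → ℝ := fun t _ => t.casesOn 0 fun t => R.output n t
    let π : ℕ → (R.system n).X × (∀ i, (R.system n).H i) := fun t =>
      (⟨x t, mem_set_nil _⟩, Fin.cases (n := 0) ⟨R.hidden n t, mem_set_nil _⟩ fun i => i.elim0)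
    have hπ : (R.system n).IsPath π := by
      refine fun t => ⟨(R.mem_system_τ n _ _ _).2 ?_, fun i => ?_⟩
      · refine Eq.trans ?_ (R.system_r n _ _).1.symm
        change _ = fun _ => R.next (R.hidden n t) R.out
        rw [← R.hidden_succ]
        rfl
      · obtain rfl : i = (0 : Fin 1) := Subsingleton.elim (α := Fin 1) _ _
        refine Subtype.ext (Eq.trans ?_ (R.system_r n _ _).2.symm)
        exact R.hidden_succ n t
    obtain ⟨t, ht⟩ := (satAt_formula x).1 (h π hπ (by
      change ConstraintCode.Holds [[ineq [1] 0], [ineq [-1] 0]] [0]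
      simp [ConstraintCode.holds_pair, ineq_holds, linForm]) (fun i => by
      obtain rfl : i = (0 : Fin 1) := Subsingleton.elim (α := Fin 1) _ _
      exact (R.holds_startConstraint n _).2 rfl))
    rcases t with _ | t
    · exact absurd ht (by norm_num [x])
    · refine ⟨t, (hR n t).resolve_left fun h0 => ?_⟩
      have : 1 / 2 < R.output n t := ht
      norm_num [h0] at this
  · rintro ⟨t, ht⟩ π hπ - hh₀
    have hh : ∀ t, ((π t).2 (0 : Fin 1)).1 = R.hidden n t := by
      intro t
      induction t with
      | zero => exact (R.holds_startConstraint n _).1 (hh₀ (0 : Fin 1))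
      | succ t ih =>
        rw [(hπ t).2 (0 : Fin 1), R.hidden_succ, ← ih]
        exact (R.system_r n _ _).2
    refine (satAt_formula _).2 ⟨t + 1, ?_⟩
    have h1 : (π (t + 1)).1.1 = fun _ => R.next (R.hidden n t) R.out := by
      rw [(R.mem_system_τ n _ _ _).1 (hπ t).1, ← hh t]
      exact (R.system_r n _ _).1
    have h2 : R.next (R.hidden n t) R.out = 1 := by
      rw [← R.hidden_succ]
      exact ht
    change 1 / 2 < (π (t + 1)).1.1 (0 : Fin 1)
    rw [h1, h2]
    norm_num

end IntNetwork

theorem not_exists_decidesVerification_unbounded :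
    ¬ ∃ f : SystemCode × List Token → Bool,
      Computable f ∧ DecidesVerification (fun _ φ => φ.IsUnbounded) f := by
  rintro ⟨f, hf, hdec⟩
  obtain ⟨R, hR, hund⟩ := exists_undecidable_network
  have h : ∀ n, f (R.systemCode n, IntNetwork.formula.word) = true ↔ ∃ t, R.output n t = 1 :=
    fun n => (hdec (R.systemCode n) (R.systemCode_valid n) IntNetwork.formula trivial).trans
      (R.satisfies_formula hR n)
  refine hund (ComputablePred.computable_iff.2 ⟨_, hf.comp
    (R.primrec_systemCode.to_comp.pair (.const IntNetwork.formula.word)), ?_⟩)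
  exact funext fun n => propext (h n).symm

end MNMASVerification

theorem mainTheorem2 :
    (¬ ∃ f : MNMASVerification.SystemCode × List MNMASVerification.Token → Bool,
      Computable f ∧ MNMASVerification.DecidesVerification (fun _ _ => True) f) ∧
    (¬ ∃ f : MNMASVerification.SystemCode × List MNMASVerification.Token → Bool,
      Computable f ∧ MNMASVerification.DecidesVerification (fun _ φ => φ.IsUnbounded) f) ∧
    (∀ c : ℝ, 0 < c → c < 1 →
      ¬ ComputablePred fun R : MNMASVerification.RNNCode =>
        R.system.Satisfies (MNMASVerification.eventuallyActionGt R.dim c)) := by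
  refine ⟨fun ⟨f, hf, hdec⟩ =>
    MNMASVerification.not_exists_decidesVerification_unbounded
      ⟨f, hf, fun c hc φ _ => hdec c hc φ trivial⟩,
    MNMASVerification.not_exists_decidesVerification_unbounded, fun c hc₀ hc₁ ⟨D, hD⟩ => ?_⟩
  obtain ⟨R, hR, hund⟩ := MNMASVerification.exists_undecidable_network
  have : ComputablePred fun n => (R.rnnCode n).system.Satisfies
      (MNMASVerification.eventuallyActionGt (R.rnnCode n).dim c) :=
    ⟨fun _ => inferInstance, hD.comp R.primrec_rnnCode.to_comp⟩
  exact hund (this.of_eq fun n => R.satisfies_rnnCode hR hc₀ hc₁ n)
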